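/- For a monoid $M$ let $\mathrm{PSh}(M)$ be the topos of right $M$-sets; a monoid homomorphism $\varphi: M\to N$ induces an essential geometric morphism $\mathrm{PSh}(M)\to\mathrm{PSh}(N)$ whose inverse image functor is restriction of the action along $\varphi$. For an object $A$ of a topos $\mathcal{E}$, the étale geometric morphism corresponding to $A$ is the canonical geometric morphism $\mathcal{E}/A\to\mathcal{E}$, with inverse image $Y\mapsto (Y\times A\to A)$. An object $A$ is locally constant if there is a family $(U_k)_{k\in K}$ of objects whose morphisms to the terminal object are jointly epimorphic such that for every $k$ there are a set $I$ and an isomorphism $A\times U_k\cong\bigsqcup_{i\in I}U_k$ over $U_k$; the étale morphism $\mathcal{E}/A\to\mathcal{E}$ is then called locally constant étale. Let $N$ be a monoid, let $N^{\ltimes}=\{u\in N : \exists v\in N,\ uv=1\}$, and let $\eta: N\to\pi_1(N)$ be the groupification of $N$, that is, the universal homomorphism from $N$ to a group. Let $g:\mathrm{PSh}(N)\to\mathrm{PSh}(\pi_1(N))$ be the geometric morphism induced by $\eta$, and let $X$ be an object of $\mathrm{PSh}(\pi_1(N))$. Then the object $g^*(X)$ of $\mathrm{PSh}(N)$ is locally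 constant, and the following are equivalent: 1. there is an equivalence of categories $\mathrm{PSh}(N)/g^*(X)\simeq\mathrm{PSh}(M)$ for some monoid $M$; 2. there is a subgroup $H\subseteq\pi_1(N)$ such that $X\cong H\backslash\pi_1(N)$ as right $\pi_1(N)$-sets and for every $y\in\pi_1(N)$ there is some $u\in\eta(N^{\ltimes})$ with $yu\in H$. In this case, for every subgroup $H$ as in (2), one can take $M=\eta^{-1}(H)\subseteq N$ in (1): there is an equivalence $\mathrm{PSh}(M)\simeq\mathrm{PSh}(N)/g^*(X)$ whose composite with the locally constant étale geometric morphism $\mathrm{PSh}(N)/g^*(X)\to\mathrm{PSh}(N)$ is isomorphic to the essential geometric morphism $\mathrm{PSh}(M)\to\mathrm{PSh}(N)$ induced by the inclusion $M\subseteq N$. -/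

import Mathlib

open CategoryTheory CategoryTheory.Limits Opposite

universe u

noncomputable section

/-! ### Geometric morphisms -/

/-- A geometric morphism `f : F → E`: an adjunction `f^* ⊣ f_*` whose left adjoint `f^* : E ⥤ F`
(the inverse image) preserves finite limits. -/
structure GeometricMorphism (F E : Type*) [Category* F] [Category* E] where
  inverseImage : E ⥤ F
  directImage : F ⥤ E
  adj : inverseImage ⊣ directImage
  preservesFiniteLimits : PreservesFiniteLimits inverseImage

namespace GeometricMorphism

variable {D E F : Type*} [Category* D] [Category* E] [Category* F]

/-- The composite `F → E → D`. -/
def comp (f : GeometricMorphism F E) (g : GeometricMorphism E D) : GeometricMorphism F D where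
  inverseImage := g.inverseImage ⋙ f.inverseImage
  directImage := f.directImage ⋙ g.directImage
  adj := g.adj.comp f.adj
  preservesFiniteLimits :=
    have := g.preservesFiniteLimits
    have := f.preservesFiniteLimits
    comp_preservesFiniteLimits _ _

/-- An equivalence of categories `F ≌ E`, regarded as a geometric morphism `F → E`. -/
def ofEquivalence (e : F ≌ E) : GeometricMorphism F E where
  inverseImage := e.inverse
  directImage := e.functor
  adj := e.symm.toAdjunction
  preservesFiniteLimits := inferInstance

/-- Two geometric morphisms agree if they are isomorphic, where a 2-morphism `f ⇒ g` is
a natural transformation `f^* ⇒ g^*`. -/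
def Agree (f g : GeometricMorphism F E) : Prop :=
  Nonempty (f.inverseImage ≅ g.inverseImage)

/-- `f` is essential if `f^*` has a left adjoint `f_!`. -/
def IsEssential (f : GeometricMorphism F E) : Prop :=
  f.inverseImage.IsRightAdjoint

/-- The étale geometric morphism `E/A → E` corresponding to an object `A`: its inverse image sends
`Y` to the projection `Y × A → A`, and its direct image sends `Z → A` to its object of sections. -/
def etale {E : Type*} [Category* E] [CartesianMonoidalCategory E] [BraidedCategory E]
    [MonoidalClosed E] [HasPullbacks E] (A : E) : GeometricMorphism (Over A) E :=
  letI : ChosenPullbacksAlong (curryRightUnitorHom A) := .ofHasPullbacksAlong _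
  { inverseImage := toOver A
    directImage := Over.sections A
    adj := Over.toOverSectionsAdj A
    preservesFiniteLimits :=
      have : PreservesLimitsOfSize.{0, 0} (toOver A) :=
        (forgetAdjToOver A).rightAdjoint_preservesLimits
      PreservesLimitsOfSize.preservesFiniteLimits _ }

end GeometricMorphism

/-! ### Toposes of right monoid actions -/

/-- `PSh(M)`, the topos of right `M`-sets: presheaves on `M` regarded as a one-object category.
An element `m : M` acts on the right on `X` by `x · m = X.map m.op x`. -/
abbrev PSh (M : Type u) [Monoid M] := (SingleObj M)ᵒᵖ ⥤ Type u

/-- The geometric morphism `PSh(M) → PSh(N)` induced by a homomorphism `φ : M →* N`: its inverse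
image restricts actions along `φ`, and its direct image is the right Kan extension. -/
def inducedGeometricMorphism {M N : Type u} [Monoid M] [Monoid N] (φ : M →* N) :
    GeometricMorphism (PSh M) (PSh N) where
  inverseImage := (Functor.whiskeringLeft _ _ (Type u)).obj (SingleObj.mapHom M N φ).op
  directImage := (SingleObj.mapHom M N φ).op.ran
  adj := (SingleObj.mapHom M N φ).op.ranAdjunction (Type u)
  preservesFiniteLimits := inferInstance

theorem inducedGeometricMorphism_isEssential {M N : Type u} [Monoid M] [Monoid N] (φ : M →* N) :
    (inducedGeometricMorphism φ).IsEssential :=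
  ((SingleObj.mapHom M N φ).op.lanAdjunction (Type u)).isRightAdjoint

/-- The submonoid `N^⋉` of right-invertible elements of `N`. -/
def rightInvertible (N : Type u) [Monoid N] : Submonoid N where
  carrier := {n | ∃ v, n * v = 1}
  one_mem' := ⟨1, one_mul 1⟩
  mul_mem' := by
    rintro a b ⟨v, hv⟩ ⟨w, hw⟩
    exact ⟨w * v, by rw [mul_assoc, ← mul_assoc b, hw, one_mul, hv]⟩

/-! ### Groupification -/

/-- The relators `[a] [b] [ab]⁻¹`. -/
def groupificationRels (N : Type u) [Monoid N] : Set (FreeGroup N) :=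
  {r | ∃ a b : N, r = FreeGroup.of a * FreeGroup.of b * (FreeGroup.of (a * b))⁻¹}

/-- The groupification `π₁(N)`: the group presented by the elements of `N` and the
multiplication table of `N`. -/
abbrev Groupification (N : Type u) [Monoid N] : Type u :=
  PresentedGroup (groupificationRels N)

namespace Groupification

variable {N : Type u} [Monoid N]

variable (N) in
/-- The groupification map `η : N → π₁(N)`. -/
def η : N →* Groupification N where
  toFun n := PresentedGroup.of n
  map_mul' a b := Eq.symm <|
    PresentedGroup.mk_eq_mk_of_mul_inv_mem (rels := groupificationRels N) ⟨a, b, rfl⟩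
  map_one' := by
    have h : (PresentedGroup.of (1 : N) * PresentedGroup.of 1 : Groupification N) =
        PresentedGroup.of (1 * 1) := PresentedGroup.mk_eq_mk_of_mul_inv_mem ⟨1, 1, rfl⟩
    rw [one_mul] at h
    exact mul_eq_left.mp h

/-- The universal property of groupification. -/
theorem existsUnique_lift {G : Type*} [Group G] (f : N →* G) :
    ∃! F : Groupification N →* G, F.comp (η N) = f := by
  have h : ∀ r ∈ groupificationRels N, FreeGroup.lift f r = 1 := by
    rintro _ ⟨a, b, rfl⟩
    simp
  refine ⟨PresentedGroup.toGroup h, ?_, fun F hF => PresentedGroup.ext fun n => ?_⟩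
  · ext n
    exact PresentedGroup.toGroup.of h
  · rw [PresentedGroup.toGroup.of h, ← hF]
    rfl

end Groupification

/-- The geometric morphism `g : PSh(N) → PSh(π₁(N))` induced by `η : N → π₁(N)`. -/
abbrev groupificationMorphism (N : Type u) [Monoid N] :
    GeometricMorphism (PSh N) (PSh (Groupification N)) :=
  inducedGeometricMorphism (Groupification.η N)

/-- The right `G`-set `H \ G` of right cosets `H y`, with `(H y) · g = H (y g)`. -/
def rightCosets {G : Type u} [Group G] (H : Subgroup G) : PSh G where
  obj _ := Quotient (QuotientGroup.rightRel H)
  map g := ↾(Quotient.map (fun y => y * (g.unop : G)) fun a b h => by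
    rw [← Quotient.eq_iff_equiv, Quotient.eq, QuotientGroup.rightRel_apply] at h ⊢
    simpa [mul_assoc] using h)
  map_id _ := by
    ext x
    induction x using Quotient.inductionOn with
    | h y => exact congrArg (Quotient.mk _) (mul_one y)
  map_comp f g := by
    ext x
    induction x using Quotient.inductionOn with
    | h y => exact congrArg (Quotient.mk _) (mul_assoc y f.unop g.unop).symm

/-! ### Locally constant objects -/

section LocallyConstant

variable {E : Type*} [Category* E] [HasTerminal E] [HasBinaryProducts E] [HasCoproducts.{u} E]

/-- `A` is trivialized by `U`: for some set `I` there is an isomorphism `A × U ≅ ⨆_{i ∈ I} U`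
over `U`. -/
def IsTrivializedBy (A U : E) : Prop :=
  ∃ (I : Type u) (ψ : A ⨯ U ≅ ∐ fun _ : I => U),
    ψ.hom ≫ Sigma.desc (fun _ => 𝟙 U) = prod.snd

/-- `A` is locally constant: it is trivialized by each member of a family of objects whose
morphisms to the terminal object are jointly epimorphic. -/
def IsLocallyConstantObject (A : E) : Prop :=
  ∃ (K : Type u) (U : K → E),
    (∀ (Z : E) (f g : ⊤_ E ⟶ Z),
      (∀ k, terminal.from (U k) ≫ f = terminal.from (U k) ≫ g) → f = g) ∧
    ∀ k, IsTrivializedBy.{u} A (U k)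

end LocallyConstant

end

/-! The slice `PSh(N)/A` is the presheaf topos on the category of elements of `A`, so it has the
form `PSh(M)` exactly when some point `a` has every point as a retract in that category: for each
`b` there are `u`, `v` with `u * v = 1` and `b · u = a`. Given such an `a`, the fibre over `a` with
its stabilizer action is an equivalence (`Retractions.faithful_fibre`, `full_fibre`,
`essSurj_fibre`), and it sends `Y × A → A` to `Y` (`toOverFibreIso`). Conversely, an equivalence
carries the regular `M`-set to an object that is a retract of one orbit object and covers every
object; composing the two maps gives the retractions (`exists_point_of_equivalence`). For `A =
g^*(X)` the relation `b · u = a` makes `X` transitive, and the retraction condition becomes the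
condition on cosets of the stabilizer `H`. Local constancy needs only that the action factors
through a group: the group itself, with `N` acting by translation, trivializes `A` via `(x, g) ↦ (x
· g⁻¹, g)`. -/

noncomputable section

/-! ### Right actions as presheaves -/

namespace PSh

variable {N : Type u} [Monoid N]

/-- The underlying set of a right `N`-set. -/
abbrev pt (X : PSh N) : Type u := X.obj (op (SingleObj.star N))

/-- An element of `N`, as a morphism of the one-object category `(SingleObj N)ᵒᵖ`. -/
abbrev arrow (n : N) : op (SingleObj.star N) ⟶ op (SingleObj.star N) :=
  Quiver.Hom.op (show SingleObj.star N ⟶ SingleObj.star N from n)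

/-- The right action `x · n`. -/
def act (X : PSh N) (x : pt X) (n : N) : pt X := X.map (arrow n) x

@[simp]
lemma act_one (X : PSh N) (x : pt X) : act X x 1 = x :=
  congrArg (fun f : pt X ⟶ pt X => f x) (X.map_id (op (SingleObj.star N)))

lemma act_mul (X : PSh N) (x : pt X) (m n : N) : act X x (m * n) = act X (act X x m) n :=
  congrArg (fun f : pt X ⟶ pt X => f x) (X.map_comp (arrow m) (arrow n))

/-- The right `N`-set with a given action. -/
def ofAct (T : Type u) (a : T → N → T) (h₁ : ∀ x, a x 1 = x)
    (h₂ : ∀ x m n, a x (m * n) = a (a x m) n) : PSh N where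
  obj _ := T
  map g := ↾fun x => a x g.unop
  map_id _ := by
    ext x
    exact h₁ x
  map_comp f g := by
    ext x
    exact h₂ x f.unop g.unop

/-- The function underlying a morphism of right `N`-sets. -/
def fn {X Y : PSh N} (f : X ⟶ Y) (x : pt X) : pt Y := f.app (op (SingleObj.star N)) x

lemma fn_act {X Y : PSh N} (f : X ⟶ Y) (x : pt X) (n : N) :
    fn f (act X x n) = act Y (fn f x) n :=
  congrArg (fun g : pt X ⟶ pt Y => g x) (f.naturality (arrow n))

@[simp]
lemma fn_comp {X Y Z : PSh N} (f : X ⟶ Y) (g : Y ⟶ Z) (x : pt X) :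
    fn (f ≫ g) x = fn g (fn f x) := rfl

@[simp]
lemma fn_id {X : PSh N} (x : pt X) : fn (𝟙 X) x = x := rfl

lemma hom_ext {X Y : PSh N} {f g : X ⟶ Y} (h : ∀ x, fn f x = fn g x) : f = g := by
  ext ⟨⟨⟩⟩ x
  exact h x

/-- An equivariant function, as a morphism of right `N`-sets. -/
def homMk {X Y : PSh N} (f : pt X → pt Y) (hf : ∀ x n, f (act X x n) = act Y (f x) n) :
    X ⟶ Y where
  app _ := ↾f
  naturality _ _ g := by
    ext x
    exact hf x g.unop

@[simp]
lemma fn_homMk {X Y : PSh N} (f : pt X → pt Y) (hf : ∀ x n, f (act X x n) = act Y (f x) n)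
    (x : pt X) : fn (homMk f hf) x = f x := rfl

/-- An equivariant bijection, as an isomorphism of right `N`-sets. -/
def isoMk {X Y : PSh N} (f : pt X ≃ pt Y) (hf : ∀ x n, f (act X x n) = act Y (f x) n) :
    X ≅ Y where
  hom := homMk f hf
  inv := homMk f.symm fun y n => by
    rw [Equiv.symm_apply_eq, hf, Equiv.apply_symm_apply]
  hom_inv_id := hom_ext f.symm_apply_apply
  inv_hom_id := hom_ext f.apply_symm_apply

@[simp]
lemma fn_hom_inv {X Y : PSh N} (e : X ≅ Y) (x : pt X) : fn e.inv (fn e.hom x) = x := by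
  rw [← fn_comp, e.hom_inv_id, fn_id]

@[simp]
lemma fn_inv_hom {X Y : PSh N} (e : X ≅ Y) (y : pt Y) : fn e.hom (fn e.inv y) = y := by
  rw [← fn_comp, e.inv_hom_id, fn_id]

/-- `N` as a right `N`-set. -/
abbrev regular (N : Type u) [Monoid N] : PSh N := ofAct N (fun x n => x * n) mul_one
  fun _ _ _ => (mul_assoc _ _ _).symm

/-- The orbit map `n ↦ x · n`. -/
def orbitMap (X : PSh N) (x : pt X) : regular N ⟶ X :=
  homMk (fun n => act X x n) fun m n => act_mul X x m n

lemma fn_regular {X : PSh N} (f : regular N ⟶ X) (n : N) :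
    fn f n = act X (fn f (1 : N)) n :=
  (congrArg (fn f) (one_mul n).symm).trans (fn_act f (1 : N) n)

@[simp]
lemma fn_orbitMap_one (X : PSh N) (x : pt X) : fn (orbitMap X x) (1 : N) = x := act_one X x

end PSh

/-! ### Jointly epimorphic families -/

/-- The morphisms `f i : Z i ⟶ W` are jointly epimorphic. -/
def JointlyEpi {C : Type*} [Category* C] {ι : Type*} {Z : ι → C} {W : C} (f : ∀ i, Z i ⟶ W) :
    Prop :=
  ∀ ⦃T : C⦄ (g h : W ⟶ T), (∀ i, f i ≫ g = f i ≫ h) → g = h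

lemma JointlyEpi.map {C D : Type*} [Category* C] [Category* D] {L : C ⥤ D} {R : D ⥤ C}
    (adj : L ⊣ R) {ι : Type*} {Z : ι → C} {W : C} {f : ∀ i, Z i ⟶ W} (hf : JointlyEpi f) :
    JointlyEpi fun i => L.map (f i) := by
  intro T g h hgh
  apply (adj.homEquiv W T).injective
  apply hf
  intro i
  rw [← adj.homEquiv_naturality_left, ← adj.homEquiv_naturality_left, hgh]

/-- The union of the images has an epimorphic inclusion, hence is everything. Joint epimorphy
survives equivalences, so this recovers elements after transport. -/
lemma JointlyEpi.exists_fn_eq {N : Type u} [Monoid N] {ι : Type*} {Z : ι → PSh N} {W : PSh N}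
    {f : ∀ i, Z i ⟶ W} (hf : JointlyEpi f) (w : PSh.pt W) :
    ∃ i z, PSh.fn (f i) z = w := by
  let S : Subfunctor W := ⨆ i, Subfunctor.range (f i)
  have hS (i) : Subfunctor.range (f i) ≤ S := le_iSup (fun i => Subfunctor.range (f i)) i
  have : Epi S.ι := ⟨fun g h hgh => hf g h fun i => by
    rw [← Subfunctor.lift_ι (f := f i) (hf := hS i), Category.assoc, hgh, Category.assoc]⟩
  have hw : w ∈ S.obj (op (SingleObj.star N)) := by
    have h := Subfunctor.range_eq_top S.ι
    rw [Subfunctor.range_ι] at h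
    rw [h]
    trivial
  simp only [S, Subfunctor.iSup_obj, Set.mem_iUnion] at hw
  exact hw

lemma PSh.jointlyEpi_regular {N : Type u} [Monoid N] (X : PSh N) :
    JointlyEpi fun x : PSh.pt X => PSh.orbitMap X x := by
  intro T g h hgh
  refine PSh.hom_ext fun x => ?_
  rw [← PSh.fn_orbitMap_one X x]
  exact congrArg (fun k => PSh.fn k (1 : N)) (hgh x)

/-! ### The fibre functor at a point -/

namespace PSh

variable {N : Type u} [Monoid N]

lemma fn_left_act_mem {A : PSh N} (a : pt A) {S : Submonoid N} (hS : ∀ n ∈ S, act A a n = a)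
    (Z : Over A) {z : pt Z.left} (hz : fn Z.hom z = a) {n : N} (hn : n ∈ S) :
    fn Z.hom (act Z.left z n) = a := by
  rw [fn_act, hz, hS n hn]

@[simp]
lemma fn_hom_left {A : PSh N} {Z W : Over A} (f : Z ⟶ W) (z : pt Z.left) :
    fn W.hom (fn f.left z) = fn Z.hom z := by
  rw [← fn_comp, Over.w]

/-- The functor sending `Z → A` to the fibre over `a`, with the action of a submonoid fixing
`a`. -/
def fibre {A : PSh N} (a : pt A) (S : Submonoid N) (hS : ∀ n ∈ S, act A a n = a) :
    Over A ⥤ PSh S where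
  obj Z := ofAct {z : pt Z.left // fn Z.hom z = a}
    (fun z n => ⟨act Z.left z.1 n, fn_left_act_mem a hS Z z.2 n.2⟩)
    (fun _ => Subtype.ext (act_one _ _)) fun _ _ _ => Subtype.ext (act_mul _ _ _ _)
  map f := homMk (fun z => ⟨fn f.left z.1, (fn_hom_left f z.1).trans z.2⟩)
    fun z n => Subtype.ext (fn_act f.left z.1 n)
  map_id _ := rfl
  map_comp _ _ := rfl

/-- Every point of `A` is a retract, in the category of elements, of the point `a` with stabilizer
`S`: for every `b` there are `u b` and `v b` with `b · u b = a`, `a · v b = b` and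
`u b * v b = 1`. -/
structure Retractions (A : PSh N) (a : pt A) (S : Submonoid N) where
  mem_iff : ∀ n, n ∈ S ↔ act A a n = a
  u : pt A → N
  v : pt A → N
  u_mul_v : ∀ b, u b * v b = 1
  act_u : ∀ b, act A b (u b) = a

namespace Retractions

variable {A : PSh N} {a : pt A} {S : Submonoid N} (r : Retractions A a S)

lemma act_v (b : pt A) : act A a (r.v b) = b := by
  have h : act A (act A b (r.u b)) (r.v b) = b := by rw [← act_mul, r.u_mul_v, act_one]
  rwa [r.act_u] at h

/-- An element `n : N`, regarded as a morphism between points `b` and `b · n`, transported to the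
stabilizer of `a`. -/
def transport (b : pt A) (n : N) : S :=
  ⟨r.v b * n * r.u (act A b n), by
    rw [r.mem_iff, act_mul, act_mul, r.act_v, r.act_u]⟩

/-- The inner factor `u * v` cancels. Units are not preserved: `transport b 1` is only the
idempotent `v b * u b`, which is why `total` passes to its fixed points. -/
lemma transport_mul (b : pt A) (m n : N) :
    r.transport b m * r.transport (act A b m) n = r.transport b (m * n) := by
  refine Subtype.ext ?_
  change r.v b * m * r.u (act A b m) * (r.v (act A b m) * n * r.u (act A (act A b m) n)) =
    r.v b * (m * n) * r.u (act A b (m * n))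
  have h : r.u (act A b m) * (r.v (act A b m) * n * r.u (act A (act A b m) n)) =
      n * r.u (act A (act A b m) n) := by
    rw [← mul_assoc, ← mul_assoc, r.u_mul_v, one_mul]
  rw [mul_assoc _ _ (_ * _ * _), h, act_mul]
  simp only [mul_assoc]

lemma u_mem : r.u a ∈ S := (r.mem_iff _).2 (r.act_u a)

lemma v_mem : r.v a ∈ S := (r.mem_iff _).2 (r.act_v a)

/-- The fibre functor at `a`. -/
abbrev fibre : Over A ⥤ PSh S := PSh.fibre a S fun n hn => (r.mem_iff n).1 hn

lemma fn_act_u (Z : Over A) (z : pt Z.left) :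
    fn Z.hom (act Z.left z (r.u (fn Z.hom z))) = a := by
  rw [fn_act, r.act_u]

lemma act_act_v (Z : PSh N) (z : pt Z) (b : pt A) : act Z (act Z z (r.u b)) (r.v b) = z := by
  rw [← act_mul, r.u_mul_v, act_one]

/-- The point `z · u` of the fibre over `a`. -/
def toFibre {Z : Over A} (z : pt Z.left) : pt (r.fibre.obj Z) :=
  ⟨act Z.left z (r.u (fn Z.hom z)), r.fn_act_u Z z⟩

/-- The point of `Z` underlying a point of the fibre. -/
def ofFibre {Z : Over A} (z : pt (r.fibre.obj Z)) : pt Z.left := z.1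

lemma fn_hom_ofFibre {Z : Over A} (z : pt (r.fibre.obj Z)) : fn Z.hom (r.ofFibre z) = a := z.2

lemma ofFibre_act {Z : Over A} (z : pt (r.fibre.obj Z)) (n : S) :
    r.ofFibre (act _ z n) = act Z.left (r.ofFibre z) n := rfl

lemma ofFibre_injective {Z : Over A} {z w : pt (r.fibre.obj Z)}
    (h : r.ofFibre z = r.ofFibre w) : z = w := Subtype.ext h

/-- The choice of `u` is not normalized by `u a = 1`, so a factor `u a` remains even over `a`. -/
lemma toFibre_ofFibre {Z : Over A} (z : pt (r.fibre.obj Z)) :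
    r.toFibre (r.ofFibre z) = act _ z ⟨r.u a, r.u_mem⟩ := by
  apply r.ofFibre_injective
  change act Z.left (r.ofFibre z) (r.u (fn Z.hom (r.ofFibre z))) = act Z.left (r.ofFibre z) (r.u a)
  rw [r.fn_hom_ofFibre]

lemma act_toFibre_v {Z : Over A} (z : pt Z.left) :
    act Z.left (r.ofFibre (r.toFibre z)) (r.v (fn Z.hom z)) = z :=
  r.act_act_v Z.left z _

lemma toFibre_act {Z : Over A} (z : pt Z.left) (n : N) :
    r.toFibre (act Z.left z n) = act _ (r.toFibre z) (r.transport (fn Z.hom z) n) := by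
  apply r.ofFibre_injective
  rw [ofFibre_act]
  change act Z.left (act Z.left z n) (r.u (fn Z.hom (act Z.left z n))) =
    act Z.left (act Z.left z _) (r.v _ * n * r.u _)
  rw [fn_act, mul_assoc, act_mul _ _ (r.v _), r.act_act_v, act_mul]

lemma ofFibre_fn_map {Z W : Over A} (f : Z ⟶ W) (z : pt (r.fibre.obj Z)) :
    r.ofFibre (fn (r.fibre.map f) z) = fn f.left (r.ofFibre z) := rfl

/-- Every `z` is its point in the fibre acted on by some `v b`, so equivariance determines a
morphism from the fibre. -/
instance faithful_fibre : r.fibre.Faithful where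
  map_injective {Z W f g} h := by
    refine Over.OverMorphism.ext (hom_ext fun z => ?_)
    have hz := congrArg (fun k => r.ofFibre (fn k (r.toFibre z))) h
    simp only [ofFibre_fn_map] at hz
    rw [← r.act_toFibre_v z, fn_act, fn_act, hz]

/-- The morphism over `A` extending a morphism of fibres. -/
def extend {Z W : Over A} (f : r.fibre.obj Z ⟶ r.fibre.obj W) : Z ⟶ W :=
  Over.homMk
    (homMk (fun z => act W.left (r.ofFibre (fn f (r.toFibre z))) (r.v (fn Z.hom z))) fun z n => by
      rw [toFibre_act, fn_act f, ofFibre_act, fn_act, ← act_mul, ← act_mul]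
      congr 1
      change r.v _ * n * r.u _ * r.v _ = r.v _ * n
      rw [mul_assoc, r.u_mul_v, mul_one])
    (hom_ext fun z => by
      rw [fn_comp, fn_homMk, fn_act, fn_hom_ofFibre, r.act_v])

instance full_fibre : r.fibre.Full where
  map_surjective {Z W} f := by
    refine ⟨r.extend f, hom_ext fun z => r.ofFibre_injective ?_⟩
    rw [ofFibre_fn_map]
    change act W.left (r.ofFibre (fn f (r.toFibre (r.ofFibre z)))) (r.v (fn Z.hom (r.ofFibre z))) =
      r.ofFibre (fn f z)
    -- The leftover `u a` is cancelled by the `v a` in `extend`.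
    rw [toFibre_ofFibre, fn_act f, ofFibre_act, fn_hom_ofFibre, r.act_act_v]

/-- The object over `A` whose fibre over `b` is the splitting of the idempotent `v b * u b` acting
on `Y`. -/
def total (Y : PSh S) : PSh N :=
  ofAct {p : pt A × pt Y // act Y p.2 (r.transport p.1 1) = p.2}
    (fun p n => ⟨(act A p.1.1 n, act Y p.1.2 (r.transport p.1.1 n)), by
      rw [← act_mul, transport_mul, mul_one]⟩)
    (fun p => Subtype.ext (Prod.ext (act_one A p.1.1) p.2))
    fun p m n => Subtype.ext (Prod.ext (act_mul A p.1.1 m n) (by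
      change act Y p.1.2 _ = act Y (act Y p.1.2 _) _
      rw [← act_mul, transport_mul]))

/-- The projection of `total` to `A`. -/
def totalProj (Y : PSh S) : r.total Y ⟶ A :=
  homMk (fun p => p.1.1) fun _ _ => rfl

lemma transport_one : r.transport a 1 = ⟨r.v a, r.v_mem⟩ * ⟨r.u a, r.u_mem⟩ := by
  refine Subtype.ext ?_
  change r.v a * 1 * r.u (act A a 1) = r.v a * r.u a
  rw [act_one, mul_one]

/-- The fibre of `total Y` over `a` is `Y`. -/
def fibreTotalIso (Y : PSh S) : r.fibre.obj (Over.mk (r.totalProj Y)) ≅ Y :=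
  isoMk
    -- Over `a`, `total Y` consists of the fixed points of `v a * u a` in `Y`; since `u a * v a =
    -- 1`, acting by `v a` and by `u a` are inverse bijections between these and `Y`.
    { toFun p := act Y p.1.1.2 ⟨r.v a, r.v_mem⟩
      invFun y := ⟨⟨(a, act Y y ⟨r.u a, r.u_mem⟩), by
        have h : (⟨r.u a, r.u_mem⟩ : S) * ⟨r.v a, r.v_mem⟩ = 1 := Subtype.ext (r.u_mul_v a)
        rw [transport_one, ← act_mul, ← mul_assoc, h, one_mul]⟩, rfl⟩
      left_inv := by
        rintro ⟨⟨⟨b, y⟩, h⟩, hb⟩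
        obtain rfl : b = a := hb
        refine Subtype.ext (Subtype.ext (Prod.ext rfl ?_))
        change act Y (act Y y _) _ = y
        rw [← act_mul, ← transport_one]
        exact h
      right_inv y := by
        change act Y (act Y y _) _ = y
        rw [← act_mul]
        exact (congrArg (act Y y) (Subtype.ext (r.u_mul_v a))).trans (act_one Y y) }
    (by
      rintro ⟨⟨⟨b, y⟩, h⟩, hb⟩ n
      obtain rfl : b = a := hb
      change act Y (act Y y (r.transport b n)) _ = act Y (act Y y _) n
      rw [← act_mul, ← act_mul]
      refine congrArg (act Y y) (Subtype.ext ?_)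
      change r.v b * n * r.u (act A b n) * r.v b = r.v b * n
      rw [(r.mem_iff n).1 n.2, mul_assoc, r.u_mul_v, mul_one])

instance essSurj_fibre : r.fibre.EssSurj where
  mem_essImage Y := ⟨Over.mk (r.totalProj Y), ⟨r.fibreTotalIso Y⟩⟩

instance isEquivalence_fibre : r.fibre.IsEquivalence where

/-- The fibre functor, as an equivalence of categories. -/
def equivalence : Over A ≌ PSh S := r.fibre.asEquivalence

end Retractions

/-- The fibre over `a` of the projection `Y × A → A` is `Y`. -/
def toOverFibreIso {A : PSh N} (a : pt A) (S : Submonoid N)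
    (hS : ∀ n ∈ S, act A a n = a) :
    (GeometricMorphism.etale A).inverseImage ⋙ fibre a S hS ≅
      (inducedGeometricMorphism S.subtype).inverseImage :=
  NatIso.ofComponents
    (fun Y => isoMk
      (X := (fibre a S hS).obj ((GeometricMorphism.etale A).inverseImage.obj Y))
      (Y := (inducedGeometricMorphism S.subtype).inverseImage.obj Y)
      { toFun p := p.1.1
        invFun y := ⟨(y, a), rfl⟩
        left_inv := by
          rintro ⟨⟨y, b⟩, hb⟩
          obtain rfl : b = a := hb
          rfl
        right_inv _ := rfl }
      fun _ _ => rfl)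
    fun _ => rfl

end PSh

/-! ### Slices equivalent to a topos of monoid actions -/

namespace PSh

variable {N : Type u} [Monoid N]

lemma regular_hom_ext {X : PSh N} {f g : regular N ⟶ X} (h : fn f (1 : N) = fn g (1 : N)) :
    f = g :=
  hom_ext fun n => by
    rw [fn_regular f n, fn_regular g n, h]

/-- The orbit map of `z`, as a morphism over `A`. -/
def orbitOver {A : PSh N} (Z : Over A) (z : pt Z.left) :
    Over.mk (orbitMap A (fn Z.hom z)) ⟶ Z :=
  Over.homMk (orbitMap Z.left z) (hom_ext fun n => fn_act Z.hom z n)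

lemma jointlyEpi_orbitOver {A : PSh N} (Z : Over A) :
    JointlyEpi fun z : pt Z.left => orbitOver Z z := by
  intro T g h hgh
  refine Over.OverMorphism.ext (jointlyEpi_regular Z.left _ _ fun z => ?_)
  exact congrArg (fun k => k.left) (hgh z)

/-- Orbit maps cover the object; after transport to `PSh M`, one of them hits the generator `1` of
the regular `M`-set, and a lift of a generator is a section. -/
lemma exists_retract_of_equivalence {A : PSh N} {M : Type u} [Monoid M]
    (E : Over A ≌ PSh M) :
    ∃ (z : pt (E.inverse.obj (regular M)).left)
      (i : E.inverse.obj (regular M) ⟶ Over.mk (orbitMap A (fn (Over.hom _) z))),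
      i ≫ orbitOver _ z = 𝟙 _ := by
  obtain ⟨z, w, hw⟩ := ((jointlyEpi_orbitOver (E.inverse.obj (regular M))).map
    E.toAdjunction).exists_fn_eq (fn (E.counitIso.inv.app (regular M)) (1 : M))
  refine ⟨z, E.functor.preimage (E.counitIso.hom.app (regular M) ≫ orbitMap _ w), ?_⟩
  apply E.functor.map_injective
  have h : orbitMap _ w ≫ E.functor.map (orbitOver _ z) = E.counitIso.inv.app (regular M) := by
    apply regular_hom_ext
    rw [← hw]
    exact congrArg _ (fn_orbitMap_one _ w)
  rw [Functor.map_comp, Functor.map_preimage, Category.assoc, h, Iso.hom_inv_id_app]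
  exact (E.functor.map_id _).symm

lemma exists_cover_of_equivalence {A : PSh N} {M : Type u} [Monoid M]
    (E : Over A ≌ PSh M) (Z : Over A) (z : pt Z.left) :
    ∃ (j : E.inverse.obj (regular M) ⟶ Z) (p : pt (E.inverse.obj (regular M)).left),
      fn j.left p = z := by
  -- Transport the orbit cover back to the slice, then forget to `PSh N`, where elements can be
  -- chosen.
  obtain ⟨x, p, hp⟩ := (((jointlyEpi_regular (E.functor.obj Z)).map
    E.symm.toAdjunction).map (forgetAdjToOver A)).exists_fn_eq
      (fn (X := Z.left) (E.unitIso.hom.app Z).left z)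
  refine ⟨E.inverse.map (orbitMap _ x) ≫ E.unitIso.inv.app Z, p, ?_⟩
  have h : (E.unitIso.hom.app Z).left ≫ (E.unitIso.inv.app Z).left = 𝟙 _ := by
    rw [← Over.comp_left, Iso.hom_inv_id_app]
    rfl
  have h' := congrArg (fun k => fn k z) h
  exact (congrArg (fn (E.unitIso.inv.app Z).left) hp).trans h'

theorem exists_point_of_equivalence {A : PSh N} {M : Type u} [Monoid M] (E : Over A ≌ PSh M) :
    ∃ a : pt A, ∀ b : pt A, ∃ u v : N, u * v = 1 ∧ act A b u = a := by
  obtain ⟨z, i, hi⟩ := exists_retract_of_equivalence E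
  refine ⟨fn (Over.hom _) z, fun b => ?_⟩
  obtain ⟨j, p, hp⟩ := exists_cover_of_equivalence E (Over.mk (orbitMap A b)) (1 : N)
  let c := orbitOver _ z ≫ j
  -- `c` goes from the orbit object of `a` to that of `b`, so it is left multiplication by `u = c
  -- 1`; the section `i` sends `p` to `v` with `c v = 1`.
  refine ⟨fn c.left (1 : N), fn i.left p, ?_, ?_⟩
  · have h : fn c.left (fn i.left p) = (1 : N) := by
      rw [← hp]
      exact congrArg (fun k => fn j.left (fn k.left p)) hi
    exact (fn_regular c.left (fn i.left p)).symm.trans h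
  · have h := congrArg (fun k => fn k (1 : N)) (Over.w c)
    exact h.trans (fn_orbitMap_one _ _)

end PSh

/-! ### Right sets over a group -/

namespace PSh

variable {G : Type u} [Group G]

lemma act_act_inv (X : PSh G) (x : pt X) (g : G) : act X (act X x g) g⁻¹ = x := by
  rw [← act_mul, mul_inv_cancel, act_one]

lemma act_inv_act (X : PSh G) (x : pt X) (g : G) : act X (act X x g⁻¹) g = x := by
  rw [← act_mul, inv_mul_cancel, act_one]

lemma act_act_mul_inv (X : PSh G) (x : pt X) (g h : G) :
    act X (act X x h) (g * h)⁻¹ = act X x g⁻¹ := by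
  rw [← act_mul, mul_inv_rev, mul_inv_cancel_left]

/-- The stabilizer of a point of a right `G`-set. -/
def stabilizer (X : PSh G) (a : pt X) : Subgroup G where
  carrier := {g | act X a g = a}
  one_mem' := act_one X a
  mul_mem' {g h} hg hh := by
    change act X a g = a at hg
    change act X a h = a at hh
    change act X a (g * h) = a
    rw [act_mul, hg, hh]
  inv_mem' {g} hg := by
    change act X a g = a at hg
    change act X a g⁻¹ = a
    nth_rw 1 [← hg]
    exact act_act_inv X a g

lemma mem_stabilizer {X : PSh G} {a : pt X} {g : G} : g ∈ stabilizer X a ↔ act X a g = a :=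
  Iff.rfl

lemma act_eq_act_iff {X : PSh G} {a : pt X} {g h : G} :
    act X a g = act X a h ↔ h * g⁻¹ ∈ stabilizer X a := by
  rw [mem_stabilizer, act_mul]
  constructor
  · intro e
    rw [← e, act_act_inv]
  · intro e
    nth_rw 1 [← e]
    exact act_inv_act X _ g

/-- A transitive right `G`-set is the set of right cosets of a stabilizer. -/
def rightCosetsIso (X : PSh G) (a : pt X) (ha : ∀ b, ∃ g, act X a g = b) :
    rightCosets (stabilizer X a) ≅ X :=
  isoMk
    (Equiv.ofBijective
      (Quotient.lift (fun g => act X a g) fun g h hgh =>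
        act_eq_act_iff.2 (QuotientGroup.rightRel_apply.1 hgh))
      ⟨by
        rintro ⟨g⟩ ⟨h⟩ hgh
        exact Quotient.sound (QuotientGroup.rightRel_apply.2 (act_eq_act_iff.1 hgh)),
      fun b => (ha b).imp' (Quotient.mk _) fun _ h => h⟩)
    (by
      rintro ⟨g⟩ h
      exact act_mul X a g h)

/-- The right coset `H y`. -/
def coset (H : Subgroup G) (y : G) : pt (rightCosets H) :=
  Quotient.mk (QuotientGroup.rightRel H) y

lemma act_coset (H : Subgroup G) (y g : G) :
    act (rightCosets H) (coset H y) g = coset H (y * g) := rfl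

lemma coset_eq_coset_one (H : Subgroup G) {y : G} : coset H y = coset H 1 ↔ y ∈ H := by
  refine (Quotient.eq (r := QuotientGroup.rightRel H)).trans ?_
  rw [QuotientGroup.rightRel_apply, one_mul, inv_mem_iff]

lemma exists_coset (H : Subgroup G) (x : pt (rightCosets H)) : ∃ y, coset H y = x :=
  Quotient.exists_rep x

end PSh

/-! ### Restrictions of group actions are locally constant -/

namespace PSh

variable {N G : Type u} [Monoid N] [Group G] (φ : N →* G)

/-- The right `N`-set underlying `G`. -/
abbrev translation : PSh N :=
  ofAct G (fun g n => g * φ n) (fun g => by rw [map_one, mul_one])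
    fun g m n => by rw [map_mul, mul_assoc]

variable (X : PSh G)

/-- The restriction of a right `G`-set along `φ`. -/
abbrev restrict : PSh N := (inducedGeometricMorphism φ).inverseImage.obj X

lemma act_restrict (x : pt X) (n : N) : act (restrict φ X) x n = act X x (φ n) := rfl

/-- The equivariant map `g ↦ x · g`. -/
def translationMap (x : pt X) : translation φ ⟶ restrict φ X :=
  homMk (fun g => act X x g) fun g n => act_mul X x g (φ n)

/-- The function `(x, g) ↦ x · g⁻¹`. -/
def component (t : pt (restrict φ X ⨯ translation φ)) : pt X :=
  act X (fn (Y := restrict φ X) prod.fst t) (fn (Y := translation φ) prod.snd t : G)⁻¹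

/-- Both coordinates are moved by the same `φ n`, which cancels in `x · g⁻¹`. -/
lemma component_act (t : pt (restrict φ X ⨯ translation φ)) (n : N) :
    component φ X (act _ t n) = component φ X t := by
  have h₁ : fn (Y := restrict φ X) prod.fst (act _ t n) =
      act X (fn (Y := restrict φ X) prod.fst t) (φ n) := fn_act prod.fst t n
  have h₂ : (fn (Y := translation φ) prod.snd (act _ t n) : G) =
      (show G from fn (Y := translation φ) prod.snd t) * φ n := fn_act prod.snd t n
  rw [component, h₁, h₂]
  exact act_act_mul_inv X _ _ _

/-- The inclusion of the component indexed by `x`. -/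
abbrev inclusion (x : pt X) : translation φ ⟶ ∐ fun _ : pt X => translation φ :=
  Sigma.ι (fun _ : pt X => translation φ) x

/-- The morphism `(x, g) ↦ g` to the component of `x · g⁻¹`. -/
def trivializationHom : restrict φ X ⨯ translation φ ⟶ ∐ fun _ : pt X => translation φ :=
  homMk (fun t => fn (inclusion φ X (component φ X t)) (fn prod.snd t)) fun t n => by
    rw [component_act, fn_act, fn_act]

/-- The morphism `g ↦ (x · g, g)` on the component of `x`. -/
def trivializationInv : ∐ (fun _ : pt X => translation φ) ⟶ restrict φ X ⨯ translation φ :=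
  Sigma.desc fun x => prod.lift (translationMap φ X x) (𝟙 _)

lemma fn_trivializationHom (t : pt (restrict φ X ⨯ translation φ)) :
    fn (trivializationHom φ X) t = fn (inclusion φ X (component φ X t)) (fn prod.snd t) := rfl

lemma component_lift (x : pt X) (g : pt (translation φ)) :
    component φ X (fn (prod.lift (translationMap φ X x) (𝟙 _)) g) = x := by
  rw [component, ← fn_comp, ← fn_comp, prod.lift_fst, prod.lift_snd]
  change act X (act X x (g : G)) (g : G)⁻¹ = x
  exact act_act_inv X x g

lemma translationMap_component (t : pt (restrict φ X ⨯ translation φ)) :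
    fn (translationMap φ X (component φ X t)) (fn prod.snd t) = fn prod.fst t :=
  act_inv_act X (fn (Y := restrict φ X) prod.fst t) (fn (Y := translation φ) prod.snd t)

/-- The isomorphism `(x, g) ↦ g` onto the component of `x · g⁻¹`. -/
def trivialization : restrict φ X ⨯ translation φ ≅ ∐ fun _ : pt X => translation φ where
  hom := trivializationHom φ X
  inv := trivializationInv φ X
  hom_inv_id := by
    have h (t) : fn (trivializationHom φ X ≫ trivializationInv φ X) t =
        fn (prod.lift (translationMap φ X (component φ X t)) (𝟙 _)) (fn prod.snd t) := by
      rw [fn_comp, fn_trivializationHom, ← fn_comp, trivializationInv, Sigma.ι_desc]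
    apply Limits.prod.hom_ext
    · refine hom_ext fun t => ?_
      rw [fn_comp, h, ← fn_comp, prod.lift_fst, translationMap_component, Category.id_comp]
    · refine hom_ext fun t => ?_
      rw [fn_comp, h, ← fn_comp, prod.lift_snd, fn_id, Category.id_comp]
  inv_hom_id := by
    refine Sigma.hom_ext _ _ fun x => hom_ext fun g => ?_
    rw [trivializationInv, Sigma.ι_desc_assoc, fn_comp, fn_trivializationHom, component_lift,
      ← fn_comp (prod.lift _ _), prod.lift_snd, fn_id, Category.comp_id]

lemma trivialization_hom_desc :
    (trivialization φ X).hom ≫ Sigma.desc (fun _ => 𝟙 (translation φ)) = prod.snd := by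
  refine hom_ext fun t => ?_
  change fn (trivializationHom φ X ≫ _) t = _
  rw [fn_comp, fn_trivializationHom, ← fn_comp, Sigma.ι_desc, fn_id]

end PSh

theorem isLocallyConstantObject_restrict {N G : Type u} [Monoid N] [Group G] (φ : N →* G)
    (X : PSh G) : IsLocallyConstantObject.{u} (PSh.restrict φ X) := by
  refine ⟨PUnit, fun _ => PSh.translation φ, fun Z f g h => PSh.hom_ext fun t => ?_, fun _ =>
    ⟨PSh.pt X, PSh.trivialization φ X, PSh.trivialization_hom_desc φ X⟩⟩
  -- A single object covers: the terminal object has only one point, as any two orbit maps into it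
  -- agree, and the group is nonempty.
  have ht : PSh.fn (terminal.from (PSh.translation φ)) (1 : G) = t := by
    refine (PSh.fn_orbitMap_one _ _).symm.trans (Eq.trans ?_ (PSh.fn_orbitMap_one _ t))
    exact congrArg (fun k : PSh.regular N ⟶ _ => PSh.fn k (1 : N)) (terminal.hom_ext _ _)
  rw [← ht]
  exact congrArg (fun k => PSh.fn k (1 : G)) (h PUnit.unit)

/-! ### The main theorem -/

/-- The retractions provided by a subgroup `H` all of whose cosets are reached from `H` by
right-invertible elements. -/
def PSh.Retractions.ofSubgroup {N G : Type u} [Monoid N] [Group G] (φ : N →* G) {X : PSh G}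
    (H : Subgroup G) (i : X ≅ rightCosets H)
    (hH : ∀ y : G, ∃ u ∈ (rightInvertible N).map φ, y * u ∈ H) :
    PSh.Retractions (PSh.restrict φ X) (PSh.fn (Y := X) i.inv (PSh.coset H 1)) (H.toSubmonoid.comap φ) :=
  have h (b : PSh.pt X) : ∃ u v : N, u * v = 1 ∧
      PSh.act X b (φ u) = PSh.fn i.inv (PSh.coset H 1) := by
    obtain ⟨y, hy⟩ := PSh.exists_coset H (PSh.fn i.hom b)
    obtain ⟨_, ⟨u, ⟨v, huv⟩, rfl⟩, hu⟩ := hH y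
    refine ⟨u, v, huv, ?_⟩
    rw [← PSh.fn_hom_inv i b, ← hy, ← PSh.fn_act, PSh.act_coset, (PSh.coset_eq_coset_one H).2 hu]
  { mem_iff n := by
      rw [PSh.act_restrict, ← PSh.fn_act, PSh.act_coset, one_mul, Submonoid.mem_comap,
        Subgroup.mem_toSubmonoid, ← PSh.coset_eq_coset_one]
      refine ⟨congrArg _, fun e => ?_⟩
      simpa using congrArg (PSh.fn i.hom) e
    u b := (h b).choose
    v b := (h b).choose_spec.choose
    u_mul_v b := (h b).choose_spec.choose_spec.1
    act_u b := (h b).choose_spec.choose_spec.2 }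

end

theorem mainTheorem11 (N : Type u) [Monoid N] (X : PSh (Groupification N)) :
    ((∃ (M : Type u) (_ : Monoid M),
        Nonempty
          (Over ((groupificationMorphism N).inverseImage.obj X) ≌ PSh M)) ↔
      ∃ H : Subgroup (Groupification N),
        Nonempty (X ≅ rightCosets H) ∧
        ∀ y : Groupification N, ∃ u ∈ (rightInvertible N).map (Groupification.η N), y * u ∈ H) ∧
    (∀ H : Subgroup (Groupification N),
      Nonempty (X ≅ rightCosets H) →
      (∀ y : Groupification N, ∃ u ∈ (rightInvertible N).map (Groupification.η N), y * u ∈ H) →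
      ∃ e : PSh (H.toSubmonoid.comap (Groupification.η N)) ≌
          Over ((groupificationMorphism N).inverseImage.obj X),
        ((GeometricMorphism.ofEquivalence e).comp (GeometricMorphism.etale
            ((groupificationMorphism N).inverseImage.obj X))).Agree
          (inducedGeometricMorphism (H.toSubmonoid.comap (Groupification.η N)).subtype)) ∧
    IsLocallyConstantObject.{u}
      ((groupificationMorphism N).inverseImage.obj X) := by
  refine ⟨⟨?_, ?_⟩, ?_, isLocallyConstantObject_restrict (Groupification.η N) X⟩
  · rintro ⟨M, _, ⟨E⟩⟩
    obtain ⟨a, ha⟩ := PSh.exists_point_of_equivalence E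
    refine ⟨PSh.stabilizer X a, ⟨(PSh.rightCosetsIso X a fun b => ?_).symm⟩, fun y => ?_⟩
    · obtain ⟨u, -, -, hu⟩ := ha b
      refine ⟨(Groupification.η N u)⁻¹, ?_⟩
      rw [← hu, PSh.act_restrict, ← PSh.act_mul, mul_inv_cancel, PSh.act_one]
    -- The coset of `y` corresponds to the point `a · y`.
    · obtain ⟨u, v, huv, hu⟩ := ha (PSh.act X a y)
      refine ⟨_, ⟨u, ⟨v, huv⟩, rfl⟩, ?_⟩
      exact (PSh.act_mul X a y _).trans hu
  · rintro ⟨H, ⟨i⟩, hH⟩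
    exact ⟨_, _, ⟨(PSh.Retractions.ofSubgroup _ H i hH).equivalence⟩⟩
  · rintro H ⟨i⟩ hH
    let r := PSh.Retractions.ofSubgroup (Groupification.η N) H i hH
    -- The inverse image of the reversed equivalence is the fibre functor itself.
    exact ⟨r.equivalence.symm, ⟨PSh.toOverFibreIso _ _ fun n => (r.mem_iff n).1⟩⟩
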